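/- Let $F(z)=e^{-z^2}\int_0^z e^{t^2}\,dt$ ($z\in\mathbb{C}$) be Dawson's integral, and for integers $m\ge 0$ let $j_m(z)=\sqrt{\pi/(2z)}\,J_{m+1/2}(z)$ be the spherical Bessel function of the first kind, understood as the entire function $$j_m(z)=\frac{\sqrt{\pi}}{2}\left(\frac z2\right)^m\sum_{k=0}^\infty\frac{(-1)^k(z/2)^{2k}}{k!\,\Gamma(m+k+\tfrac32)}\qquad(z\in\mathbb{C}).$$ Then, for all $w\in\mathbb{C}$ and $\theta\in\mathbb{R}$, $$F(w\cos\theta)=w\,e^{-w^2/2}\sum_{m=0}^\infty(-i)^m\,j_m(-iw^2/2)\,\cos((2m+1)\theta),$$ and, as a consequence, for all $w\in\mathbb{C}$, $$F(2w)=2F(w)+6w\,e^{-2w^2}\sum_{m=0}^\infty(-1)^m\left[j_{6m+4}(-2iw^2)-i\,j_{6m+1}(-2iw^2)\right],$$ where both series converge absolutely. -/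

import Mathlib

/-- Dawson's integral `F(z) = e^{-z²} ∫₀^z e^{t²} dt` for complex `z`. The integrand is entire, so
the integral does not depend on the path; it is taken along the segment `t ↦ t z`, `0 ≤ t ≤ 1`. -/
noncomputable def dawson (z : ℂ) : ℂ :=
  Complex.exp (-z ^ 2) * ∫ t in (0 : ℝ)..1, Complex.exp (((t : ℂ) * z) ^ 2) * z

/-- The power series `∑_{k ≥ 0} (-1)^k (z/2)^{2k} / (k! Γ(μ+k+1))`. -/
noncomputable def besselSeries (μ z : ℂ) : ℂ :=
  ∑' k : ℕ, (-1 : ℂ) ^ k * (z / 2) ^ (2 * k) / ((k.factorial : ℂ) * Complex.Gamma (μ + k + 1))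

/-- Bessel function of the first kind (principal branch of the power). -/
noncomputable def besselJ (μ z : ℂ) : ℂ :=
  (z / 2) ^ μ * besselSeries μ z

/-- Spherical Bessel function of the first kind `j_m(z) = √(π/(2z)) J_{m+1/2}(z)`, `m ≥ 0`, as an
entire function of `z`: the product of `√(π/(2z))` and `(z/2)^{m+1/2}` is `(√π/2) (z/2)^m`, which
removes the singularity at `0` and the branch cut (see `sphericalBesselJ_eq`). -/
noncomputable def sphericalBesselJ (m : ℕ) (z : ℂ) : ℂ :=
  (Real.sqrt Real.pi : ℂ) / 2 * (z / 2) ^ m * besselSeries ((m : ℂ) + 1 / 2) z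

theorem sphericalBesselJ_eq (m : ℕ) {z : ℂ} (hz : z ∈ Complex.slitPlane) :
    sphericalBesselJ m z =
      ((Real.pi : ℂ) / (2 * z)) ^ (1 / 2 : ℂ) * besselJ ((m : ℂ) + 1 / 2) z := by
  have hz0 : z ≠ 0 := Complex.slitPlane_ne_zero hz
  have hz2 : z / 2 ≠ 0 := div_ne_zero hz0 two_ne_zero
  have harg : (z / 2).arg = z.arg := by
    have h : z / 2 = ((1 / 2 : ℝ) : ℂ) * z := by push_cast; ring
    rw [h, Complex.arg_real_mul _ (by norm_num)]
  have hne : (z / 2).arg ≠ Real.pi := by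
    rw [harg]
    exact (Complex.mem_slitPlane_iff_arg.1 hz).1
  have h1 : (Real.pi : ℂ) / (2 * z) = ((Real.pi / 4 : ℝ) : ℂ) * (z / 2)⁻¹ := by
    push_cast
    field_simp
    ring
  have h2 : ((Real.pi / 4 : ℝ) : ℂ) ^ (1 / 2 : ℂ) = (Real.sqrt Real.pi : ℂ) / 2 := by
    have h3 : Real.sqrt (Real.pi / 4) = Real.sqrt Real.pi / 2 := by
      rw [Real.sqrt_div' _ (by norm_num), show (4 : ℝ) = 2 ^ 2 by norm_num,
        Real.sqrt_sq (by norm_num)]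
    have h4 : ((1 / 2 : ℝ) : ℂ) = (1 / 2 : ℂ) := by push_cast; ring
    rw [← h4, ← Complex.ofReal_cpow (by positivity), ← Real.sqrt_eq_rpow, h3]
    push_cast
    ring
  have h5 : (z / 2) ^ (1 / 2 : ℂ) ≠ 0 := by
    rw [Complex.cpow_def_of_ne_zero hz2]
    exact Complex.exp_ne_zero _
  have h6 : ((Real.pi : ℂ) / (2 * z)) ^ (1 / 2 : ℂ) =
      (Real.sqrt Real.pi : ℂ) / 2 * ((z / 2) ^ (1 / 2 : ℂ))⁻¹ := by
    have hp : (0 : ℝ) < Real.pi / 4 := by positivity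
    have hc : ((Real.pi / 4 : ℝ) : ℂ) ≠ 0 := Complex.ofReal_ne_zero.2 hp.ne'
    rw [← h2, ← Complex.inv_cpow _ _ hne, h1,
      Complex.cpow_def_of_ne_zero (mul_ne_zero hc (inv_ne_zero hz2)),
      Complex.cpow_def_of_ne_zero hc, Complex.cpow_def_of_ne_zero (inv_ne_zero hz2),
      Complex.log_ofReal_mul hp (inv_ne_zero hz2), Complex.ofReal_log hp.le, add_mul,
      Complex.exp_add]
  rw [sphericalBesselJ, besselJ, h6, Complex.cpow_add _ _ hz2, Complex.cpow_natCast]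
  field_simp

/-! Put z = -iw²/2 and let S(θ) be the cosine series. The recurrence z(j_m + j_{m+2}) = (2m+3)
j_{m+1} together with the closed forms of j_0 and j_1 gives S' = 2iz sin(2θ) S - e^{iz} sin θ
(`tsum_sphericalBesselJ_mul_sin`). Since iz = w²/2, the integrating factor is e^{w² cos²θ}, and w
e^{-w²/2} S satisfies the same first-order equation as θ ↦ F(w cos θ). Both vanish at θ = π/2, so
they agree.

For the second formula, take 2w at θ = 0 and θ = π/3: the weights 1 - 2cos((2n+1)π/3) in F(2w) -
2F(w) select the orders n ≡ 1 mod 3 (`tsum_sphericalBesselJ_six`).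

Convergence and termwise differentiation rest on the factorial decay of j_m(z) in m. -/

/-! ### Bounds and absolute convergence. -/

theorem factorial_mul_Gamma_le (m : ℕ) :
    (m.factorial : ℝ) * Real.Gamma (3 / 2) ≤ Real.Gamma (m + 3 / 2) := by
  induction m with
  | zero => simp
  | succ m ih =>
    have hpos : (0 : ℝ) < (m : ℝ) + 3 / 2 := by positivity
    have h : ((m + 1 : ℕ) : ℝ) + 3 / 2 = ((m : ℝ) + 3 / 2) + 1 := by push_cast; ring
    rw [h, Real.Gamma_add_one hpos.ne', Nat.factorial_succ, Nat.cast_mul, mul_assoc]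
    have hG : (0 : ℝ) ≤ (m.factorial : ℝ) * Real.Gamma (3 / 2) :=
      mul_nonneg (by positivity) (Real.Gamma_pos_of_pos (by norm_num)).le
    exact mul_le_mul (by push_cast; linarith) ih hG hpos.le

theorem Complex.Gamma_nat_add_three_halves (n : ℕ) :
    Complex.Gamma ((n : ℂ) + 3 / 2) = (Real.Gamma (n + 3 / 2) : ℂ) := by
  rw [← Complex.Gamma_ofReal]; push_cast; rfl

theorem norm_besselSeries_term_le (m k : ℕ) (z : ℂ) :
    ‖(-1 : ℂ) ^ k * (z / 2) ^ (2 * k) /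
        ((k.factorial : ℂ) * Complex.Gamma ((m : ℂ) + 1 / 2 + k + 1))‖ ≤
      ((m.factorial : ℝ) * Real.Gamma (3 / 2))⁻¹ * ((‖z / 2‖ ^ 2) ^ k / k.factorial) := by
  have h : (m : ℂ) + 1 / 2 + k + 1 = ((m + k : ℕ) : ℂ) + 3 / 2 := by push_cast; ring
  have hG : 0 < Real.Gamma (3 / 2) := Real.Gamma_pos_of_pos (by norm_num)
  have hle : (m.factorial : ℝ) * Real.Gamma (3 / 2) ≤ Real.Gamma ((m + k : ℕ) + 3 / 2) :=
    (mul_le_mul_of_nonneg_right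
      (by exact_mod_cast Nat.factorial_le (Nat.le_add_right m k)) hG.le).trans
      (factorial_mul_Gamma_le (m + k))
  have hm : 0 < (m.factorial : ℝ) * Real.Gamma (3 / 2) := by positivity
  rw [h, Complex.Gamma_nat_add_three_halves, norm_div, norm_mul, norm_mul, norm_pow, norm_neg,
    norm_one, one_pow, one_mul, norm_pow, pow_mul, Complex.norm_natCast, Complex.norm_real,
    Real.norm_of_nonneg (hm.le.trans hle), mul_comm (k.factorial : ℝ), div_mul_eq_div_div_swap,
    div_eq_inv_mul _ (Real.Gamma _)]
  gcongr

theorem summable_besselSeries_term (m : ℕ) (z : ℂ) :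
    Summable fun k : ℕ => (-1 : ℂ) ^ k * (z / 2) ^ (2 * k) /
        ((k.factorial : ℂ) * Complex.Gamma ((m : ℂ) + 1 / 2 + k + 1)) :=
  .of_norm_bounded ((Real.summable_pow_div_factorial _).mul_left _)
    fun k => norm_besselSeries_term_le m k z

/-- The prefactor √π/2 equals Γ(3/2) and cancels the constant of the termwise bound. -/
theorem norm_sphericalBesselJ_le (m : ℕ) (z : ℂ) :
    ‖sphericalBesselJ m z‖ ≤ Real.exp (‖z / 2‖ ^ 2) * (‖z / 2‖ ^ m / m.factorial) := by
  have hb : ‖besselSeries ((m : ℂ) + 1 / 2) z‖ ≤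
      ((m.factorial : ℝ) * Real.Gamma (3 / 2))⁻¹ * Real.exp (‖z / 2‖ ^ 2) := by
    refine tsum_of_norm_bounded ?_ fun k => norm_besselSeries_term_le m k z
    rw [Real.exp_eq_exp_ℝ]
    exact (NormedSpace.expSeries_div_hasSum_exp (𝔸 := ℝ) _).mul_left _
  have hG : Real.Gamma (3 / 2) = Real.sqrt Real.pi / 2 := by
    rw [show (3 / 2 : ℝ) = 1 / 2 + 1 by norm_num, Real.Gamma_add_one (by norm_num),
      Real.Gamma_one_half_eq]
    ring
  have hpi : 0 < Real.sqrt Real.pi := Real.sqrt_pos.2 Real.pi_pos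
  have hn : ‖(Real.sqrt Real.pi : ℂ) / 2‖ = Real.sqrt Real.pi / 2 := by
    rw [norm_div, Complex.norm_real, Real.norm_of_nonneg hpi.le, Complex.norm_ofNat]
  rw [sphericalBesselJ, norm_mul, norm_mul, norm_pow, hn]
  calc _ ≤ Real.sqrt Real.pi / 2 * ‖z / 2‖ ^ m *
        (((m.factorial : ℝ) * Real.Gamma (3 / 2))⁻¹ * Real.exp (‖z / 2‖ ^ 2)) := by gcongr
    _ = _ := by
      rw [hG]
      have : (m.factorial : ℝ) ≠ 0 := by positivity
      field_simp

/-- The weight 2m+1 is what differentiating cos((2m+1)θ) produces; bounding it by 2·2^m keeps the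
majorant exponential. -/
theorem summable_mul_norm_sphericalBesselJ (z : ℂ) :
    Summable fun m : ℕ => (2 * (m : ℝ) + 1) * ‖sphericalBesselJ m z‖ := by
  have hs : Summable fun m : ℕ =>
      2 * (Real.exp (‖z / 2‖ ^ 2) * ((2 * ‖z / 2‖) ^ m / m.factorial)) :=
    ((Real.summable_pow_div_factorial _).mul_left _).mul_left _
  refine hs.of_nonneg_of_le (fun m => by positivity) fun m => ?_
  have h2 : 2 * (m : ℝ) + 1 ≤ 2 * 2 ^ m := by
    have : m + 1 ≤ 2 ^ m := Nat.lt_two_pow_self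
    have : (m : ℝ) + 1 ≤ 2 ^ m := by exact_mod_cast this
    linarith
  calc _ ≤ (2 * 2 ^ m) * (Real.exp (‖z / 2‖ ^ 2) * (‖z / 2‖ ^ m / m.factorial)) :=
        mul_le_mul h2 (norm_sphericalBesselJ_le m z) (norm_nonneg _) (by positivity)
    _ = _ := by rw [mul_pow]; ring

theorem summable_norm_sphericalBesselJ (z : ℂ) :
    Summable fun m : ℕ => ‖sphericalBesselJ m z‖ :=
  (summable_mul_norm_sphericalBesselJ z).of_nonneg_of_le (fun _ => norm_nonneg _) fun m =>
    le_mul_of_one_le_left (norm_nonneg _) (by have := m.cast_nonneg (α := ℝ); linarith)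

/-! ### Recurrence in the order and closed forms at low order. -/

/-- The three-term recurrence in the order, `z/2 (J_{μ-1} + J_{μ+1}) = μ J_μ`, for the power
series. -/
theorem besselSeries_recurrence (m : ℕ) (z : ℂ) :
    besselSeries ((m : ℂ) - 1 / 2) z =
      ((m : ℂ) + 1 / 2) * besselSeries ((m : ℂ) + 1 / 2) z -
        (z / 2) ^ 2 * besselSeries (((m + 1 : ℕ) : ℂ) + 1 / 2) z := by
  have h1 := (summable_besselSeries_term m z).hasSum.mul_left ((m : ℂ) + 1 / 2)
  have h2 := (summable_besselSeries_term (m + 1) z).hasSum.mul_left (-(z / 2) ^ 2)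
  -- With μ = m + 1/2, Γ(μ+k+1) = (μ+k)Γ(μ+k) turns the left side into the order-μ series weighted
  -- by μ + k. The weight k kills the term k = 0, and k/k! = 1/(k-1)! shifts the rest to order μ +
  -- 1.
  have h3 : HasSum (fun k : ℕ => (k : ℂ) * ((-1 : ℂ) ^ k * (z / 2) ^ (2 * k) /
      ((k.factorial : ℂ) * Complex.Gamma ((m : ℂ) + 1 / 2 + k + 1))))
      (-(z / 2) ^ 2 * besselSeries (((m + 1 : ℕ) : ℂ) + 1 / 2) z) := by
    rw [← hasSum_nat_add_iff' 1]
    simp only [Finset.range_one, Finset.sum_singleton, Nat.cast_zero, zero_mul, sub_zero]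
    refine h2.congr_fun fun k => ?_
    have hk : ((k : ℂ) + 1) ≠ 0 := Nat.cast_add_one_ne_zero k
    have hf : (k.factorial : ℂ) ≠ 0 := Nat.cast_ne_zero.2 k.factorial_ne_zero
    rw [Nat.factorial_succ,
      show ((m + 1 : ℕ) : ℂ) + 1 / 2 + k + 1 = (m : ℂ) + 1 / 2 + (k + 1 : ℕ) + 1 by
        push_cast; ring]
    push_cast
    rw [mul_assoc ((k : ℂ) + 1), ← mul_div_assoc, mul_div_mul_left _ _ hk]
    ring
  rw [sub_eq_add_neg (_ * _), ← neg_mul]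
  refine HasSum.tsum_eq ((h1.add h3).congr_fun fun k => ?_)
  have hne : (m : ℂ) + 1 / 2 + k ≠ 0 := by
    rw [show (m : ℂ) + 1 / 2 + k = ((m + 1 / 2 + k : ℝ) : ℂ) by push_cast; ring]
    exact Complex.ofReal_ne_zero.2 (by positivity)
  rw [Complex.Gamma_add_one _ hne, show (m : ℂ) - 1 / 2 + k + 1 = m + 1 / 2 + k by ring,
    ← add_mul, mul_left_comm (k.factorial : ℂ), ← mul_div_assoc, mul_div_mul_left _ _ hne]

theorem sphericalBesselJ_recurrence (m : ℕ) (z : ℂ) :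
    z * (sphericalBesselJ m z + sphericalBesselJ (m + 2) z) =
      (2 * (m : ℂ) + 3) * sphericalBesselJ (m + 1) z := by
  have h := besselSeries_recurrence (m + 1) z
  rw [show ((m + 1 : ℕ) : ℂ) - 1 / 2 = (m : ℂ) + 1 / 2 by push_cast; ring] at h
  simp only [sphericalBesselJ]
  rw [h]
  generalize besselSeries (((m + 1 : ℕ) : ℂ) + 1 / 2) z = A
  generalize besselSeries (((m + 1 + 1 : ℕ) : ℂ) + 1 / 2) z = B
  push_cast
  ring

/-- Legendre duplication at half-integers; it turns the series of orders ∓1/2 into those of cosine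
and sine. -/
theorem Complex.Gamma_nat_add_half_mul_factorial (k : ℕ) :
    (k.factorial : ℂ) * Complex.Gamma ((k : ℂ) + 1 / 2) * 2 ^ (2 * k) =
      (2 * k).factorial * (Real.sqrt Real.pi : ℂ) := by
  induction k with
  | zero =>
    have h := Complex.Gamma_one_half_eq
    rw [Real.sqrt_eq_rpow, Complex.ofReal_cpow Real.pi_pos.le]
    simpa using h
  | succ k ih =>
    have hne : (k : ℂ) + 1 / 2 ≠ 0 := by
      rw [show (k : ℂ) + 1 / 2 = ((k + 1 / 2 : ℝ) : ℂ) by push_cast; ring]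
      exact Complex.ofReal_ne_zero.2 (by positivity)
    rw [show ((k + 1 : ℕ) : ℂ) + 1 / 2 = ((k : ℂ) + 1 / 2) + 1 by push_cast; ring,
      Complex.Gamma_add_one _ hne, show 2 * (k + 1) = 2 * k + 1 + 1 by ring]
    simp only [Nat.factorial_succ]
    push_cast
    linear_combination (2 * (k : ℂ) + 1) * (2 * k + 2) * ih

theorem sqrt_pi_mul_besselSeries_neg_half (z : ℂ) :
    (Real.sqrt Real.pi : ℂ) * besselSeries (-1 / 2) z = Complex.cos z := by
  rw [besselSeries, ← tsum_mul_left, Complex.cos_eq_tsum]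
  refine tsum_congr fun k => ?_
  have hG := Complex.Gamma_nat_add_half_mul_factorial k
  have hpi : (Real.sqrt Real.pi : ℂ) ≠ 0 :=
    Complex.ofReal_ne_zero.2 (Real.sqrt_pos.2 Real.pi_pos).ne'
  have hf : ((2 * k).factorial : ℂ) ≠ 0 := Nat.cast_ne_zero.2 (Nat.factorial_ne_zero _)
  have h0 : (k.factorial : ℂ) * Complex.Gamma ((k : ℂ) + 1 / 2) ≠ 0 :=
    left_ne_zero_of_mul (hG ▸ mul_ne_zero hf hpi)
  rw [show (-1 / 2 : ℂ) + k + 1 = k + 1 / 2 by ring, ← mul_div_assoc, div_eq_div_iff h0 hf,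
    div_pow]
  have h2 : (2 : ℂ) ^ (2 * k) ≠ 0 := pow_ne_zero _ two_ne_zero
  generalize Complex.Gamma ((k : ℂ) + 1 / 2) = G at *
  field_simp
  linear_combination -z ^ (2 * k) * hG

theorem mul_sphericalBesselJ_zero (z : ℂ) :
    z * sphericalBesselJ 0 z = Complex.sin z := by
  rw [sphericalBesselJ, besselSeries, pow_zero, mul_one, ← tsum_mul_left, ← tsum_mul_left,
    Complex.sin_eq_tsum]
  refine tsum_congr fun k => ?_
  have hG := Complex.Gamma_nat_add_half_mul_factorial k
  have hpi : (Real.sqrt Real.pi : ℂ) ≠ 0 :=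
    Complex.ofReal_ne_zero.2 (Real.sqrt_pos.2 Real.pi_pos).ne'
  have hf : ((2 * k).factorial : ℂ) ≠ 0 := Nat.cast_ne_zero.2 (Nat.factorial_ne_zero _)
  have h0 : (k.factorial : ℂ) * Complex.Gamma ((k : ℂ) + 1 / 2) ≠ 0 :=
    left_ne_zero_of_mul (hG ▸ mul_ne_zero hf hpi)
  have hne : (k : ℂ) + 1 / 2 ≠ 0 := by
    rw [show (k : ℂ) + 1 / 2 = ((k + 1 / 2 : ℝ) : ℂ) by push_cast; ring]
    exact Complex.ofReal_ne_zero.2 (by positivity)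
  have hne' : 2 * (k : ℂ) + 1 ≠ 0 := by
    intro h; exact hne (by linear_combination h / 2)
  rw [show ((0 : ℕ) : ℂ) + 1 / 2 + k + 1 = k + 1 / 2 + 1 by push_cast; ring,
    Complex.Gamma_add_one _ hne, Nat.factorial_succ, div_pow, mul_left_comm (k.factorial : ℂ),
    ← mul_div_assoc, ← mul_div_assoc,
    div_eq_div_iff (mul_ne_zero hne h0) (by push_cast; exact mul_ne_zero hne' hf)]
  have h2 : (2 : ℂ) ^ (2 * k) ≠ 0 := pow_ne_zero _ two_ne_zero
  generalize Complex.Gamma ((k : ℂ) + 1 / 2) = G at *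
  push_cast
  field_simp
  linear_combination -z ^ (2 * k + 1) * hG

/-- This is the recurrence at its lowest order, where the series of order -1/2 is a cosine. -/
theorem sphericalBesselJ_zero_sub (z : ℂ) :
    sphericalBesselJ 0 z - z * sphericalBesselJ 1 z = Complex.cos z := by
  have h := besselSeries_recurrence 0 z
  rw [← sqrt_pi_mul_besselSeries_neg_half,
    show (-1 / 2 : ℂ) = ((0 : ℕ) : ℂ) - 1 / 2 by push_cast; ring, h]
  simp only [sphericalBesselJ]
  push_cast
  ring

/-! ### The differential equation in θ and the cosine expansion. -/

/-- The integral part of `dawson (w * c)`, as a function of the real variable `c`, is a primitive of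
`w e^{(c w)²}`. -/
theorem hasDerivAt_exp_mul_dawson (w : ℂ) (c : ℝ) :
    HasDerivAt (fun c : ℝ => Complex.exp ((w * c) ^ 2) * dawson (w * c))
      (Complex.exp ((c * w) ^ 2) * w) c := by
  have hcont : Continuous fun s : ℝ => Complex.exp ((s * w) ^ 2) * w := by fun_prop
  have heq : (fun c : ℝ => Complex.exp ((w * c) ^ 2) * dawson (w * c)) =
      fun c : ℝ => ∫ s in (0 : ℝ)..c, Complex.exp ((s * w) ^ 2) * w := by
    funext c
    have hsub := intervalIntegral.smul_integral_comp_mul_left (a := 0) (b := 1)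
      (fun s : ℝ => Complex.exp ((s * w) ^ 2) * w) c
    rw [mul_zero, mul_one] at hsub
    rw [← hsub, dawson, ← mul_assoc, ← Complex.exp_add, add_neg_cancel, Complex.exp_zero, one_mul,
      ← intervalIntegral.integral_smul]
    refine intervalIntegral.integral_congr fun t _ => ?_
    simp only [Complex.real_smul]
    push_cast
    rw [show (t : ℂ) * (w * c) = c * t * w by ring]
    ring
  rw [heq]
  exact intervalIntegral.integral_hasDerivAt_right (hcont.intervalIntegrable _ _)
    (hcont.stronglyMeasurableAtFilter _ _) hcont.continuousAt

theorem norm_neg_I_pow (m : ℕ) : ‖(-Complex.I) ^ m‖ = 1 := by simp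

theorem summable_sphericalBesselJ_mul_cos (z : ℂ) (θ : ℝ) :
    Summable fun m : ℕ => (-Complex.I) ^ m * sphericalBesselJ m z *
      (Real.cos ((2 * (m : ℝ) + 1) * θ) : ℂ) := by
  refine .of_norm_bounded (summable_norm_sphericalBesselJ z) fun m => ?_
  rw [norm_mul, norm_mul, norm_neg_I_pow, one_mul, Complex.norm_real]
  exact mul_le_of_le_one_right (norm_nonneg _) (Real.abs_cos_le_one _)

theorem norm_sphericalBesselJ_mul_sin_le (m : ℕ) (z : ℂ) (θ : ℝ) :
    ‖(-Complex.I) ^ m * sphericalBesselJ m z *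
      ((-Real.sin ((2 * (m : ℝ) + 1) * θ) * (2 * (m : ℝ) + 1) : ℝ) : ℂ)‖ ≤
      (2 * (m : ℝ) + 1) * ‖sphericalBesselJ m z‖ := by
  have h : ‖-Real.sin ((2 * (m : ℝ) + 1) * θ) * (2 * (m : ℝ) + 1)‖ ≤ 2 * (m : ℝ) + 1 := by
    rw [norm_mul, norm_neg, Real.norm_of_nonneg (by positivity : (0 : ℝ) ≤ 2 * m + 1)]
    exact mul_le_of_le_one_left (by positivity) (Real.abs_sin_le_one _)
  rw [norm_mul, norm_mul, norm_neg_I_pow, one_mul, Complex.norm_real, mul_comm]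
  exact mul_le_mul_of_nonneg_right h (norm_nonneg _)

theorem hasDerivAt_tsum_sphericalBesselJ_mul_cos (z : ℂ) (θ : ℝ) :
    HasDerivAt (fun θ : ℝ => ∑' m : ℕ, (-Complex.I) ^ m * sphericalBesselJ m z *
        (Real.cos ((2 * (m : ℝ) + 1) * θ) : ℂ))
      (∑' m : ℕ, (-Complex.I) ^ m * sphericalBesselJ m z *
        ((-Real.sin ((2 * (m : ℝ) + 1) * θ) * (2 * (m : ℝ) + 1) : ℝ) : ℂ)) θ := by
  have hd : ∀ (m : ℕ) (y : ℝ), HasDerivAt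
      (fun y : ℝ => (-Complex.I) ^ m * sphericalBesselJ m z *
        (Real.cos ((2 * (m : ℝ) + 1) * y) : ℂ))
      ((-Complex.I) ^ m * sphericalBesselJ m z *
        ((-Real.sin ((2 * (m : ℝ) + 1) * y) * (2 * (m : ℝ) + 1) : ℝ) : ℂ)) y := fun m y => by
    have h : HasDerivAt (fun y : ℝ => Real.cos ((2 * (m : ℝ) + 1) * y))
        (-Real.sin ((2 * (m : ℝ) + 1) * y) * (2 * (m : ℝ) + 1)) y := by
      simpa using ((hasDerivAt_id y).const_mul (2 * (m : ℝ) + 1)).cos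
    exact h.ofReal_comp.const_mul _
  exact hasDerivAt_tsum (summable_mul_norm_sphericalBesselJ z) hd
    (fun m y => norm_sphericalBesselJ_mul_sin_le m z y) (y₀ := θ)
    (summable_sphericalBesselJ_mul_cos z θ) θ

/-- The differential equation in `θ` satisfied by the cosine series, in the form obtained by
multiplying out `sin (2θ) cos ((2m+1)θ)` and applying the three-term recurrence. -/
theorem tsum_sphericalBesselJ_mul_sin (z : ℂ) (θ : ℝ) :
    ∑' m : ℕ, (-Complex.I) ^ m * sphericalBesselJ m z *
        ((-Real.sin ((2 * (m : ℝ) + 1) * θ) * (2 * (m : ℝ) + 1) : ℝ) : ℂ) =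
      2 * Complex.I * z * Real.sin (2 * θ) *
        (∑' m : ℕ, (-Complex.I) ^ m * sphericalBesselJ m z *
          (Real.cos ((2 * (m : ℝ) + 1) * θ) : ℂ)) -
      Complex.exp (Complex.I * z) * Real.sin θ := by
  set c : ℕ → ℂ := fun m => (-Complex.I) ^ m * sphericalBesselJ m z with hc
  set s : ℕ → ℂ := fun m => (Real.sin ((2 * (m : ℝ) + 1) * θ) : ℂ) with hs
  have hcs : Summable fun m => ‖c m‖ := by
    simpa [hc] using summable_norm_sphericalBesselJ z
  have hsn : ∀ m, ‖s m‖ ≤ 1 := fun m => by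
    rw [hs, Complex.norm_real]; exact Real.abs_sin_le_one _
  have hup : Summable fun m => c m * s (m + 1) :=
    .of_norm_bounded hcs fun m => by
      rw [norm_mul]; exact mul_le_of_le_one_right (norm_nonneg _) (hsn _)
  have hdown : Summable fun m => c (m + 1) * s m :=
    .of_norm_bounded ((summable_nat_add_iff 1).2 hcs) fun m => by
      rw [norm_mul]; exact mul_le_of_le_one_right (norm_nonneg _) (hsn _)
  have hdown2 : Summable fun m => c (m + 2) * s (m + 1) :=
    (summable_nat_add_iff 1).2 hdown
  have hsin0 : s 0 = Real.sin θ := by simp [hs]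
  have hcos : ∀ m : ℕ, 2 * (Real.sin (2 * θ) : ℂ) * Real.cos ((2 * ((m + 1 : ℕ) : ℝ) + 1) * θ) =
      s (m + 2) - s m := fun m => by
    have h1 := Real.sin_add ((2 * ((m + 1 : ℕ) : ℝ) + 1) * θ) (2 * θ)
    have h2 := Real.sin_sub ((2 * ((m + 1 : ℕ) : ℝ) + 1) * θ) (2 * θ)
    rw [show (2 * ((m + 1 : ℕ) : ℝ) + 1) * θ + 2 * θ = (2 * ((m + 2 : ℕ) : ℝ) + 1) * θ by
      push_cast; ring] at h1
    rw [show (2 * ((m + 1 : ℕ) : ℝ) + 1) * θ - 2 * θ = (2 * (m : ℝ) + 1) * θ by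
      push_cast; ring] at h2
    simp only [hs, h1, h2]
    push_cast
    ring
  -- At m = 0 the lower sine is sin(-θ) = -s 0, hence the changed sign.
  have hcos0 : 2 * (Real.sin (2 * θ) : ℂ) * Real.cos ((2 * ((0 : ℕ) : ℝ) + 1) * θ) =
      s 1 + s 0 := by
    have h1 := Real.sin_add θ (2 * θ)
    have h2 := Real.sin_sub θ (2 * θ)
    rw [show θ + 2 * θ = (2 * ((1 : ℕ) : ℝ) + 1) * θ by push_cast; ring] at h1
    rw [show θ - 2 * θ = -((2 * ((0 : ℕ) : ℝ) + 1) * θ) by push_cast; ring, Real.sin_neg,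
      neg_eq_iff_eq_neg] at h2
    simp only [hs, h1, h2]
    push_cast
    ring_nf
  have hrhs : 2 * (Real.sin (2 * θ) : ℂ) *
      (∑' m : ℕ, c m * (Real.cos ((2 * (m : ℝ) + 1) * θ) : ℂ)) =
      c 0 * s 0 - c 1 * s 0 + ∑' m, (c m * s (m + 1) - c (m + 2) * s (m + 1)) := by
    rw [(summable_sphericalBesselJ_mul_cos z θ).tsum_eq_zero_add, mul_add, mul_left_comm, hcos0,
      ← tsum_mul_left, tsum_congr (g := fun m => c (m + 1) * s (m + 2) - c (m + 1) * s m)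
        fun m => by rw [mul_left_comm, hcos m, mul_sub],
      ((summable_nat_add_iff 1).2 hup).tsum_sub hdown, hup.tsum_sub hdown2,
      hup.tsum_eq_zero_add, hdown.tsum_eq_zero_add]
    ring
  have hlhs : Summable fun m : ℕ =>
      c m * ((-Real.sin ((2 * (m : ℝ) + 1) * θ) * (2 * (m : ℝ) + 1) : ℝ) : ℂ) :=
    .of_norm_bounded (summable_mul_norm_sphericalBesselJ z)
      fun m => norm_sphericalBesselJ_mul_sin_le m z θ
  -- The factor (-i)^{m+2} = -(-i)^m turns the sum in the recurrence into a difference.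
  have hterm : ∀ m : ℕ, c (m + 1) *
      ((-Real.sin ((2 * ((m + 1 : ℕ) : ℝ) + 1) * θ) * (2 * ((m + 1 : ℕ) : ℝ) + 1) : ℝ) : ℂ) =
      Complex.I * z * (c m * s (m + 1) - c (m + 2) * s (m + 1)) := fun m => by
    have h := sphericalBesselJ_recurrence m z
    simp only [hc, hs, pow_succ]
    push_cast
    linear_combination (-Complex.I) ^ m * Complex.I *
      Complex.sin ((2 * ((m : ℂ) + 1) + 1) * θ) *
      (z * sphericalBesselJ (m + 2) z * Complex.I_sq - h)
  -- The m = 0 terms escape the recurrence; by Euler's formula they account exactly for the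
  -- inhomogeneous term.
  have hexp : Complex.exp (Complex.I * z) =
      c 0 + Complex.I * z * (c 0 - c 1) := by
    have h0 := mul_sphericalBesselJ_zero z
    have h1 := sphericalBesselJ_zero_sub z
    rw [mul_comm, Complex.exp_mul_I, ← h0, ← h1]
    simp only [hc, pow_zero, pow_one]
    linear_combination (-z * sphericalBesselJ 1 z) * Complex.I_sq
  rw [show 2 * Complex.I * z * (Real.sin (2 * θ) : ℂ) = Complex.I * z * (2 * Real.sin (2 * θ)) by
    ring, mul_assoc, hrhs, hexp, hlhs.tsum_eq_zero_add, tsum_congr hterm, tsum_mul_left, ← hsin0]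
  simp only [hs]
  push_cast
  ring

theorem dawson_mul_cos (w : ℂ) (θ : ℝ) :
    dawson (w * (Real.cos θ : ℂ)) =
      w * Complex.exp (-w ^ 2 / 2) *
        ∑' m : ℕ, (-Complex.I) ^ m * sphericalBesselJ m (-Complex.I * w ^ 2 / 2) *
          (Real.cos ((2 * (m : ℝ) + 1) * θ) : ℂ) := by
  set z : ℂ := -Complex.I * w ^ 2 / 2 with hz
  set S : ℝ → ℂ := fun θ => ∑' m : ℕ, (-Complex.I) ^ m * sphericalBesselJ m z *
    (Real.cos ((2 * (m : ℝ) + 1) * θ) : ℂ) with hS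
  have hIz : Complex.I * z = w ^ 2 / 2 := by
    rw [hz]; linear_combination (-w ^ 2 / 2) * Complex.I_sq
  -- The difference of the two sides times the integrating factor, so that D' = 0.
  set D : ℝ → ℂ := fun θ => Complex.exp ((w * (Real.cos θ : ℝ)) ^ 2) *
    (dawson (w * (Real.cos θ : ℝ)) - w * Complex.exp (-w ^ 2 / 2) * S θ) with hD
  have hderiv : ∀ θ, HasDerivAt D 0 θ := fun θ => by
    have h1 := (hasDerivAt_exp_mul_dawson w (Real.cos θ)).scomp θ (Real.hasDerivAt_cos θ)
    have hcos := ((Real.hasDerivAt_cos θ).ofReal_comp.const_mul w).pow 2 |>.cexp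
    have h2 := hcos.mul ((hasDerivAt_tsum_sphericalBesselJ_mul_cos z θ).const_mul
      (w * Complex.exp (-w ^ 2 / 2)))
    rw [tsum_sphericalBesselJ_mul_sin, mul_assoc 2, hIz] at h2
    have h3 := h1.sub h2
    have he : Complex.exp (-w ^ 2 / 2) * Complex.exp (w ^ 2 / 2) = 1 := by
      rw [← Complex.exp_add, ← Complex.exp_zero]; ring_nf
    refine (h3.congr_deriv ?_).congr_of_eventuallyEq (.of_forall fun θ => ?_)
    · rw [Real.sin_two_mul, Complex.real_smul, mul_comm (Real.cos θ : ℂ) w]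
      push_cast
      linear_combination (w * Complex.exp ((w * Complex.cos θ) ^ 2) * Complex.sin θ) * he
    · simp only [hD, hS, Function.comp_apply, Pi.sub_apply, Pi.mul_apply, Pi.pow_apply]
      ring
  have hconst : D θ = D (Real.pi / 2) :=
    is_const_of_deriv_eq_zero (fun x => (hderiv x).differentiableAt)
      (fun x => (hderiv x).deriv) _ _
  -- Every cos((2m+1)π/2) vanishes, and so does the Dawson integral at 0.
  have hzero : D (Real.pi / 2) = 0 := by
    have hSz : S (Real.pi / 2) = 0 := by
      rw [hS]
      refine (tsum_congr fun m => ?_).trans tsum_zero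
      rw [show (2 * (m : ℝ) + 1) * (Real.pi / 2) = Real.pi / 2 + m * Real.pi by ring,
        Real.cos_add_nat_mul_pi, Real.cos_pi_div_two]
      simp
    simp [hD, hSz, dawson]
  exact sub_eq_zero.1 ((mul_eq_zero.1 (hconst.trans hzero)).resolve_left (Complex.exp_ne_zero _))

/-! ### The formula for F(2w). -/

theorem one_sub_two_mul_cos_odd_mul_pi_div_three (n : ℕ) :
    1 - 2 * Real.cos ((2 * (n : ℝ) + 1) * (Real.pi / 3)) = if n % 3 = 1 then 3 else 0 := by
  induction n using Nat.strong_induction_on with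
  | _ n ih =>
    match n with
    | 0 => norm_num [Real.cos_pi_div_three]
    | 1 =>
      rw [show (2 * ((1 : ℕ) : ℝ) + 1) * (Real.pi / 3) = Real.pi by push_cast; ring, Real.cos_pi]
      norm_num
    | 2 =>
      rw [show (2 * ((2 : ℕ) : ℝ) + 1) * (Real.pi / 3) = 2 * Real.pi - Real.pi / 3 by
        push_cast; ring, Real.cos_two_pi_sub, Real.cos_pi_div_three]
      norm_num
    | n + 3 =>
      rw [show (2 * ((n + 3 : ℕ) : ℝ) + 1) * (Real.pi / 3) =
          (2 * (n : ℝ) + 1) * (Real.pi / 3) + 2 * Real.pi by push_cast; ring,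
        Real.cos_add_two_pi, ih n (by omega), Nat.add_mod_right]

theorem summable_sphericalBesselJ_six (z : ℂ) :
    Summable fun m : ℕ => (-1 : ℂ) ^ m *
      (sphericalBesselJ (6 * m + 4) z - Complex.I * sphericalBesselJ (6 * m + 1) z) := by
  have h4 : Summable fun m : ℕ => ‖sphericalBesselJ (6 * m + 4) z‖ :=
    (summable_norm_sphericalBesselJ z).comp_injective (i := fun m => 6 * m + 4)
      fun a b h => by simpa using h
  have h1 : Summable fun m : ℕ => ‖sphericalBesselJ (6 * m + 1) z‖ :=
    (summable_norm_sphericalBesselJ z).comp_injective (i := fun m => 6 * m + 1)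
      fun a b h => by simpa using h
  refine .of_norm_bounded (h4.add h1) fun m => ?_
  rw [norm_mul, norm_pow, norm_neg, norm_one, one_pow, one_mul]
  exact (norm_sub_le _ _).trans_eq (by simp)

theorem tsum_sphericalBesselJ_six (z : ℂ) :
    (∑' m : ℕ, (-Complex.I) ^ m * sphericalBesselJ m z *
        (Real.cos ((2 * (m : ℝ) + 1) * 0) : ℂ)) -
      2 * (∑' m : ℕ, (-Complex.I) ^ m * sphericalBesselJ m z *
        (Real.cos ((2 * (m : ℝ) + 1) * (Real.pi / 3)) : ℂ)) =
      3 * ∑' m : ℕ, (-1 : ℂ) ^ m *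
        (sphericalBesselJ (6 * m + 4) z - Complex.I * sphericalBesselJ (6 * m + 1) z) := by
  set c : ℕ → ℂ := fun m => (-Complex.I) ^ m * sphericalBesselJ m z with hc
  have hcs : Summable c := by
    refine .of_norm ?_
    simpa [hc] using summable_norm_sphericalBesselJ z
  have hinj : Function.Injective fun m : ℕ => 3 * m + 1 := fun a b h => by simpa using h
  have hinj1 : Function.Injective fun m : ℕ => 6 * m + 1 := fun a b h => by simpa using h
  have hinj4 : Function.Injective fun m : ℕ => 6 * m + 4 := fun a b h => by simpa using h
  have hterm : ∀ m : ℕ, c m * (Real.cos ((2 * (m : ℝ) + 1) * 0) : ℂ) -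
      2 * (c m * (Real.cos ((2 * (m : ℝ) + 1) * (Real.pi / 3)) : ℂ)) =
      3 * if m % 3 = 1 then c m else 0 := fun m => by
    have h := congrArg (Complex.ofReal) (one_sub_two_mul_cos_odd_mul_pi_div_three m)
    rw [Complex.ofReal_sub, Complex.ofReal_mul] at h
    rw [mul_zero, Real.cos_zero]
    split_ifs at h ⊢ <;> push_cast at h ⊢ <;> linear_combination c m * h
  have hthree : ∑' m : ℕ, (if m % 3 = 1 then c m else 0) = ∑' n : ℕ, c (3 * n + 1) := by
    rw [← hinj.tsum_eq]
    · exact tsum_congr fun n => if_pos (by omega)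
    · intro m hm
      have hm3 : m % 3 = 1 := by
        by_contra h
        exact hm (if_neg h)
      exact ⟨m / 3, by simp only; omega⟩
  -- Splitting the orders 3n+1 by the parity of n gives 6m+1 and 6m+4.
  have h1 : Summable fun m => c (3 * (2 * m) + 1) :=
    (hcs.comp_injective hinj1).congr fun m => by simp only [Function.comp_apply]; ring_nf
  have h4 : Summable fun m => c (3 * (2 * m + 1) + 1) :=
    (hcs.comp_injective hinj4).congr fun m => by simp only [Function.comp_apply]; ring_nf
  have hsub := ((summable_sphericalBesselJ_mul_cos z 0).hasSum.sub
    ((summable_sphericalBesselJ_mul_cos z (Real.pi / 3)).hasSum.mul_left 2)).tsum_eq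
  refine hsub.symm.trans ((tsum_congr hterm).trans ?_)
  rw [tsum_mul_left, hthree, ← tsum_even_add_odd (f := fun n => c (3 * n + 1)) h1 h4,
    ← h1.tsum_add h4]
  refine congrArg _ (tsum_congr fun m => ?_)
  -- Since (-i)^6 = -1, the coefficients at 6m+1 and 6m+4 are (-1)^m(-i) and (-1)^m.
  have hI : (-Complex.I) ^ (6 * m) = (-1 : ℂ) ^ m := by
    rw [pow_mul]
    congr 1
    linear_combination (Complex.I ^ 4 - Complex.I ^ 2 + 1) * Complex.I_sq
  simp only [hc]
  rw [show 3 * (2 * m) + 1 = 6 * m + 1 by ring, show 3 * (2 * m + 1) + 1 = 6 * m + 4 by ring,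
    pow_add, pow_add, hI]
  linear_combination (-1 : ℂ) ^ m * sphericalBesselJ (6 * m + 4) z *
    (Complex.I ^ 2 - 1) * Complex.I_sq

theorem dawson_two_mul (w : ℂ) :
    dawson (2 * w) =
      2 * dawson w + 6 * w * Complex.exp (-2 * w ^ 2) *
        ∑' m : ℕ, (-1 : ℂ) ^ m *
          (sphericalBesselJ (6 * m + 4) (-2 * Complex.I * w ^ 2) -
            Complex.I * sphericalBesselJ (6 * m + 1) (-2 * Complex.I * w ^ 2)) := by
  have h0 := dawson_mul_cos (2 * w) 0
  have h1 := dawson_mul_cos (2 * w) (Real.pi / 3)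
  have h := tsum_sphericalBesselJ_six (-2 * Complex.I * w ^ 2)
  have hz : -Complex.I * (2 * w) ^ 2 / 2 = -2 * Complex.I * w ^ 2 := by ring
  have he : -(2 * w) ^ 2 / 2 = -2 * w ^ 2 := by ring
  have hw : 2 * w * ((Real.cos (Real.pi / 3) : ℝ) : ℂ) = w := by
    rw [Real.cos_pi_div_three]; push_cast; ring
  rw [hz, he, Real.cos_zero, Complex.ofReal_one, mul_one] at h0
  rw [hz, he, hw] at h1
  rw [h0, h1]
  linear_combination 2 * w * Complex.exp (-2 * w ^ 2) * h

theorem mainTheorem9 :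
    (∀ (w : ℂ) (θ : ℝ),
      Summable (fun m : ℕ => (-Complex.I) ^ m * sphericalBesselJ m (-Complex.I * w ^ 2 / 2) *
        (Real.cos ((2 * (m : ℝ) + 1) * θ) : ℂ)) ∧
      dawson (w * (Real.cos θ : ℂ)) =
        w * Complex.exp (-w ^ 2 / 2) *
          ∑' m : ℕ, (-Complex.I) ^ m * sphericalBesselJ m (-Complex.I * w ^ 2 / 2) *
            (Real.cos ((2 * (m : ℝ) + 1) * θ) : ℂ)) ∧
    (∀ w : ℂ,
      Summable (fun m : ℕ => (-1 : ℂ) ^ m *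
        (sphericalBesselJ (6 * m + 4) (-2 * Complex.I * w ^ 2) -
          Complex.I * sphericalBesselJ (6 * m + 1) (-2 * Complex.I * w ^ 2))) ∧
      dawson (2 * w) =
        2 * dawson w + 6 * w * Complex.exp (-2 * w ^ 2) *
          ∑' m : ℕ, (-1 : ℂ) ^ m *
            (sphericalBesselJ (6 * m + 4) (-2 * Complex.I * w ^ 2) -
              Complex.I * sphericalBesselJ (6 * m + 1) (-2 * Complex.I * w ^ 2))) := by
  exact ⟨fun w θ => ⟨summable_sphericalBesselJ_mul_cos _ θ, dawson_mul_cos w θ⟩,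
    fun w => ⟨summable_sphericalBesselJ_six _, dawson_two_mul w⟩⟩
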